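/- Let $(\Omega,\mathcal A,m)$ be a measure space with $m(\Omega)<\infty$, let $d_1,d_2>0$, and let $A\colon L^2(\Omega)\to L^2(\Omega)$ (real $L^2$) be the bounded linear operator $Av=d_1v+d_2\langle 1,v\rangle$, where $\langle 1,v\rangle=\int_\Omega v\,\mathrm dm$ is regarded as a constant function. Let $F_u,F_w,F_\xi\in L^2(\Omega)$, let $\Omega=\Omega^{0+}\cup\Omega^{00}\cup\Omega^{+0}$ be a partition into measurable sets, and let $\Omega_w\subset\Omega$ be measurable. Consider the problem $$ (\mathrm{MPCC}_{\mathrm{lin}})\qquad \begin{aligned} \min_{u,w,\xi\in L^2(\Omega)}\quad & \langle F_u,u\rangle+\langle F_w,w\rangle+\langle F_\xi,\xi\rangle\\ \text{s.t.}\quad & Au-w-\xi=0,\\ & u=0\ \text{ a.e. on }\Omega^{0+},\qquad \xi=0\ \text{ a.e. on }\Omega^{+0},\\ & u\ge 0,\ \ \xi\ge 0,\ \ u\xi=0\ \text{ a.e. on }\Omega^{00},\\ & w\ge 0\ \text{ a.e. on }\Omega_w . \end{aligned} $$ If $(0,0,0)$ is a (global) minimizer of $(\mathrm{MPCC}_{\mathrm{lin}})$,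 then $(0,0,0)$ is an M-stationary point of it, i.e. there exist multipliers $\bar p,\bar\mu,\bar\nu,\bar\lambda\in L^2(\Omega)$ such that $$ F_u+A^*\bar p+\bar\mu=0,\qquad F_w-\bar p+\bar\lambda=0,\qquad F_\xi-\bar p+\bar\nu=0, $$ $$ \bar\lambda\le 0\ \text{ a.e. on }\Omega_w,\qquad \bar\lambda=0\ \text{ a.e. on }\Omega\setminus\Omega_w,\qquad \bar\mu=0\ \text{ a.e. on }\Omega^{+0},\qquad \bar\nu=0\ \text{ a.e. on }\Omega^{0+}, $$ $$ (\bar\mu<0\ \wedge\ \bar\nu<0)\ \vee\ \bar\mu\bar\nu=0\qquad\text{a.e. on }\Omega^{00}. $$ -/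

import Mathlib

open MeasureTheory

/-- The data of the linear MPCC on the measure space `(Ω, m)`: a bounded linear operator `A` on the
real space `L²(m)`, the coefficients `Fu, Fw, Fξ` of the objective, a measurable partition
`Ω⁰⁺, Ω⁰⁰, Ω⁺⁰` of `Ω` (`zp`, `zz`, `pz`), and a measurable set `Ω_w` (`sw`). -/
structure LinearMPCC {Ω : Type*} [MeasurableSpace Ω] (m : Measure Ω) where
  A : Lp ℝ 2 m →L[ℝ] Lp ℝ 2 m
  Fu : Lp ℝ 2 m
  Fw : Lp ℝ 2 m
  Fξ : Lp ℝ 2 m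
  zp : Set Ω
  zz : Set Ω
  pz : Set Ω
  sw : Set Ω
  measurableSet_zp : MeasurableSet zp
  measurableSet_zz : MeasurableSet zz
  measurableSet_pz : MeasurableSet pz
  measurableSet_sw : MeasurableSet sw
  disjoint_zp_zz : Disjoint zp zz
  disjoint_zp_pz : Disjoint zp pz
  disjoint_zz_pz : Disjoint zz pz
  cover : zp ∪ zz ∪ pz = Set.univ

namespace LinearMPCC

variable {Ω : Type*} [MeasurableSpace Ω] {m : Measure Ω}

/-- The objective `⟨Fu, u⟩ + ⟨Fw, w⟩ + ⟨Fξ, ξ⟩`. -/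
noncomputable def objective (P : LinearMPCC m) (u w ξ : Lp ℝ 2 m) : ℝ :=
  inner ℝ P.Fu u + inner ℝ P.Fw w + inner ℝ P.Fξ ξ

/-- The constraints of the linear MPCC. -/
structure Feasible (P : LinearMPCC m) (u w ξ : Lp ℝ 2 m) : Prop where
  state : P.A u - w - ξ = 0
  u_zp : ∀ᵐ x ∂m, x ∈ P.zp → u x = 0
  compl : ∀ᵐ x ∂m, x ∈ P.zz → 0 ≤ u x ∧ u x * ξ x = 0 ∧ 0 ≤ ξ x
  ξ_pz : ∀ᵐ x ∂m, x ∈ P.pz → ξ x = 0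
  w_sw : ∀ᵐ x ∂m, x ∈ P.sw → 0 ≤ w x

/-- `(u, w, ξ)` is a (global) minimizer of the linear MPCC. -/
def IsMinimizer (P : LinearMPCC m) (u w ξ : Lp ℝ 2 m) : Prop :=
  P.Feasible u w ξ ∧
    ∀ u' w' ξ' : Lp ℝ 2 m, P.Feasible u' w' ξ' → P.objective u w ξ ≤ P.objective u' w' ξ'

/-- `(p, μ, lam, ν)` are multipliers for the system of M-stationarity of the linear MPCC at
`(u, w, ξ)`. Here `p` belongs to the equation `A u - w - ξ = 0` and `lam` to `w ≥ 0` on `Ω_w`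
(extended by zero); `μ` collects the multipliers of `u = 0` on `Ω⁰⁺` and of `u ≥ 0` on `Ω⁰⁰`, and
`ν` those of `ξ = 0` on `Ω⁺⁰` and of `ξ ≥ 0` on `Ω⁰⁰` (both extended by zero). -/
structure IsMMultiplier (P : LinearMPCC m) (u w ξ p μ lam ν : Lp ℝ 2 m) : Prop where
  eq_u : P.Fu + ContinuousLinearMap.adjoint P.A p + μ = 0
  eq_w : P.Fw - p + lam = 0
  eq_ξ : P.Fξ - p + ν = 0
  lam_nonpos : ∀ᵐ x ∂m, x ∈ P.sw → lam x ≤ 0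
  lam_inactive : ∀ᵐ x ∂m, x ∈ P.sw → 0 < w x → lam x = 0
  lam_zero : ∀ᵐ x ∂m, x ∉ P.sw → lam x = 0
  μ_pz : ∀ᵐ x ∂m, x ∈ P.pz → μ x = 0
  ν_zp : ∀ᵐ x ∂m, x ∈ P.zp → ν x = 0
  μ_inactive : ∀ᵐ x ∂m, x ∈ P.zz → 0 < u x → μ x = 0
  ν_inactive : ∀ᵐ x ∂m, x ∈ P.zz → 0 < ξ x → ν x = 0
  m_cond : ∀ᵐ x ∂m, x ∈ P.zz → u x = 0 → ξ x = 0 → (μ x < 0 ∧ ν x < 0) ∨ μ x * ν x = 0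

/-- `(u, w, ξ)` is an M-stationary point of the linear MPCC. -/
def IsMStationary (P : LinearMPCC m) (u w ξ : Lp ℝ 2 m) : Prop :=
  P.Feasible u w ξ ∧ ∃ p μ lam ν : Lp ℝ 2 m, P.IsMMultiplier u w ξ p μ lam ν

/-- At `(0, 0, 0)` the definition of M-stationarity is the explicit system without the inactivity
conditions. -/
theorem isMStationary_zero_iff (P : LinearMPCC m) :
    P.IsMStationary 0 0 0 ↔ ∃ p μ lam ν : Lp ℝ 2 m,
      P.Fu + ContinuousLinearMap.adjoint P.A p + μ = 0 ∧ P.Fw - p + lam = 0 ∧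
      P.Fξ - p + ν = 0 ∧
      (∀ᵐ x ∂m, x ∈ P.sw → lam x ≤ 0) ∧ (∀ᵐ x ∂m, x ∉ P.sw → lam x = 0) ∧
      (∀ᵐ x ∂m, x ∈ P.pz → μ x = 0) ∧ (∀ᵐ x ∂m, x ∈ P.zp → ν x = 0) ∧
      (∀ᵐ x ∂m, x ∈ P.zz → (μ x < 0 ∧ ν x < 0) ∨ μ x * ν x = 0) := by
  have h0 : ∀ᵐ x ∂m, (0 : Lp ℝ 2 m) x = 0 := Lp.coeFn_zero ℝ 2 m
  constructor
  · rintro ⟨-, p, μ, lam, ν, h⟩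
    refine ⟨p, μ, lam, ν, h.eq_u, h.eq_w, h.eq_ξ, h.lam_nonpos, h.lam_zero, h.μ_pz, h.ν_zp, ?_⟩
    filter_upwards [h0, h.m_cond] with x hx h1 hz using h1 hz hx hx
  · rintro ⟨p, μ, lam, ν, h1, h2, h3, h4, h5, h6, h7, h8⟩
    refine ⟨⟨by simp, ?_, ?_, ?_, ?_⟩, p, μ, lam, ν, h1, h2, h3, h4, ?_, h5, h6, h7, ?_, ?_, ?_⟩
    · filter_upwards [h0] with x hx using fun _ => hx
    · filter_upwards [h0] with x hx using fun _ => ⟨hx.ge, by rw [hx, mul_zero], hx.ge⟩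
    · filter_upwards [h0] with x hx using fun _ => hx
    · filter_upwards [h0] with x hx using fun _ => hx.ge
    · filter_upwards [h0] with x hx using fun _ h => absurd h hx.not_gt
    · filter_upwards [h0] with x hx using fun _ h => absurd h hx.not_gt
    · filter_upwards [h0] with x hx using fun _ h => absurd h hx.not_gt
    · filter_upwards [h8] with x hx using fun hz _ _ => hx hz

end LinearMPCC

namespace LinearMPCC

variable {Ω : Type*} [MeasurableSpace Ω] {m : Measure Ω}

/-! Eliminating w = Au − ξ and using A* = A, the objective becomes ∫ (aU + bX) with a = Fu + A Fw
and b = Fξ − Fw. One function lam then fixes all multipliers: p = Fw + lam, μ = −(a + A lam), ν =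
lam − b. The only nonlocal term is the scalar s = d₂ ∫ lam. Once s is given, the conditions are
pointwise: they force lam off Ω⁰⁰ ∩ Ω_w and leave a choice v there (`weight`), so s must solve a
fixed-point equation.

If Ω⁺⁰ \ Ω_w is null, v = min(0, b) makes this equation affine in s and solvable; a test triple then
yields the signs of a + s (`exists_scalar_of_null`). Otherwise U is free on a set of positive
measure, so the coupling ∫ U = t can be dropped at the price of a multiplier s
(`integral_nonneg_of_ne_null`). This s is prescribed; tests with t = 1 and t = −1 bracket it between
d₂ ∫ lam for two choices of v, and interpolation attains it (`exists_multiplier`). -/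

theorem mem_cases (P : LinearMPCC m) (x : Ω) :
    (x ∈ P.zp ∧ x ∉ P.zz ∧ x ∉ P.pz) ∨ (x ∉ P.zp ∧ x ∈ P.zz ∧ x ∉ P.pz) ∨
      (x ∉ P.zp ∧ x ∉ P.zz ∧ x ∈ P.pz) := by
  have h : x ∈ P.zp ∪ P.zz ∪ P.pz := P.cover ▸ Set.mem_univ x
  have h1 : x ∈ P.zp → x ∉ P.zz := fun h => Set.disjoint_left.mp P.disjoint_zp_zz h
  have h2 : x ∈ P.zp → x ∉ P.pz := fun h => Set.disjoint_left.mp P.disjoint_zp_pz h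
  have h3 : x ∈ P.zz → x ∉ P.pz := fun h => Set.disjoint_left.mp P.disjoint_zz_pz h
  simp only [Set.mem_union] at h
  tauto

/-! ### Reduction to a problem in u and ξ with one scalar coupling. -/

/-- Square-integrable functions `U`, `X` satisfying the pointwise constraints of the linear MPCC
with `A U` replaced by `d₁ U + d₂ t`. -/
structure PointwiseFeasible (P : LinearMPCC m) (d₁ d₂ t : ℝ) (U X : Ω → ℝ) : Prop where
  memLp_u : MemLp U 2 m
  memLp_ξ : MemLp X 2 m
  u_zp : ∀ x ∈ P.zp, U x = 0
  ξ_pz : ∀ x ∈ P.pz, X x = 0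
  compl : ∀ x ∈ P.zz, 0 ≤ U x ∧ U x * X x = 0 ∧ 0 ≤ X x
  w_sw : ∀ x ∈ P.sw, X x ≤ d₁ * U x + d₂ * t

theorem inner_eq_integral_mul (f g : Lp ℝ 2 m) : inner ℝ f g = ∫ x, f x * g x ∂m := by
  rw [L2.inner_def]
  simp [mul_comm]

/-- The operator `v ↦ d₁ v + d₂ ∫ v` is self-adjoint. -/
theorem adjoint_eq_self [IsFiniteMeasure m] (A : Lp ℝ 2 m →L[ℝ] Lp ℝ 2 m) (d₁ d₂ : ℝ)
    (hA : ∀ v : Lp ℝ 2 m, ∀ᵐ x ∂m, A v x = d₁ * v x + d₂ * ∫ y, v y ∂m) :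
    ContinuousLinearMap.adjoint A = A := by
  have key : ∀ v w : Lp ℝ 2 m,
      inner ℝ (A v) w = d₁ * (∫ x, v x * w x ∂m) + d₂ * (∫ x, v x ∂m) * ∫ x, w x ∂m := by
    intro v w
    have hvw : Integrable (fun x => v x * w x) m := (Lp.memLp v).integrable_mul (Lp.memLp w)
    have hw : Integrable (fun x => w x) m := (Lp.memLp w).integrable (by norm_num)
    rw [inner_eq_integral_mul,
      integral_congr_ae (g := fun x => d₁ * (v x * w x) + d₂ * (∫ y, v y ∂m) * w x),
      integral_add (hvw.const_mul _) (hw.const_mul _), integral_const_mul, integral_const_mul]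
    filter_upwards [hA v] with x hx
    rw [hx]
    ring
  refine ((ContinuousLinearMap.eq_adjoint_iff A A).mpr fun v w => ?_).symm
  rw [key, real_inner_comm, key]
  simp only [mul_comm (w _)]
  ring

/-- The reduced objective is nonnegative at pointwise feasible functions if `0` is a minimizer. -/
theorem IsMinimizer.integral_nonneg [IsFiniteMeasure m] {P : LinearMPCC m} {d₁ d₂ : ℝ}
    (hA : ∀ v : Lp ℝ 2 m, ∀ᵐ x ∂m, P.A v x = d₁ * v x + d₂ * ∫ y, v y ∂m)
    (hmin : P.IsMinimizer 0 0 0) {t : ℝ} {U X : Ω → ℝ} (h : P.PointwiseFeasible d₁ d₂ t U X)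
    (ht : ∫ x, U x ∂m = t) :
    0 ≤ ∫ x, ((P.Fu + P.A P.Fw : Lp ℝ 2 m) x * U x + (P.Fξ - P.Fw : Lp ℝ 2 m) x * X x) ∂m := by
  set u := h.memLp_u.toLp U
  set ξ := h.memLp_ξ.toLp X
  have hu : u =ᵐ[m] U := h.memLp_u.coeFn_toLp
  have hξ : ξ =ᵐ[m] X := h.memLp_ξ.coeFn_toLp
  have hfeas : P.Feasible u (P.A u - ξ) ξ := by
    refine ⟨by abel, ?_, ?_, ?_, ?_⟩
    · filter_upwards [hu] with x hx hz
      rw [hx, h.u_zp x hz]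
    · filter_upwards [hu, hξ] with x hx hx' hz
      rw [hx, hx']
      exact h.compl x hz
    · filter_upwards [hξ] with x hx hz
      rw [hx, h.ξ_pz x hz]
    · filter_upwards [hu, hξ, hA u, Lp.coeFn_sub (P.A u) ξ] with x hx hx' hAx hs hz
      rw [hs, Pi.sub_apply, hAx, hx, hx', integral_congr_ae hu, ht]
      linarith [h.w_sw x hz]
  have hobj := hmin.2 _ _ _ hfeas
  have hadj : inner ℝ P.Fw (P.A u) = inner ℝ (P.A P.Fw) u := by
    conv_rhs => rw [← adjoint_eq_self P.A d₁ d₂ hA, ContinuousLinearMap.adjoint_inner_left]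
  have hval : P.objective u (P.A u - ξ) ξ =
      inner ℝ (P.Fu + P.A P.Fw) u + inner ℝ (P.Fξ - P.Fw) ξ := by
    simp only [objective, inner_sub_right, inner_add_left, inner_sub_left, hadj]
    ring
  rw [hval, inner_eq_integral_mul, inner_eq_integral_mul, ← integral_add] at hobj
  · simp only [objective, inner_zero_right, add_zero] at hobj
    refine hobj.trans_eq (integral_congr_ae ?_)
    filter_upwards [hu, hξ] with x hx hx'
    rw [hx, hx']
  · exact (Lp.memLp _).integrable_mul (Lp.memLp u)
  · exact (Lp.memLp _).integrable_mul (Lp.memLp ξ)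

/-- A nonpositive integrable function with nonnegative integral vanishes almost everywhere. -/
theorem ae_eq_zero_of_nonpos_of_integral_nonneg {f : Ω → ℝ} (hf : Integrable f m)
    (h : ∀ x, f x ≤ 0) (hi : 0 ≤ ∫ x, f x ∂m) : ∀ᵐ x ∂m, f x = 0 := by
  have h0 : ∫ x, (-f) x ∂m = 0 := by
    simp only [Pi.neg_apply, integral_neg]
    linarith [integral_nonpos (μ := m) h]
  filter_upwards [(integral_eq_zero_iff_of_nonneg (fun x => neg_nonneg.mpr (h x)) hf.neg).mp h0]
    with x hx
  simpa using hx

/-- The product is minus the square of the negative part. Testing with the negative part of a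
coefficient therefore forces that coefficient to be nonnegative almost everywhere. -/
theorem mul_max_neg_zero_nonpos (y : ℝ) : y * max (-y) 0 ≤ 0 := by
  rcases le_total (-y) 0 with h | h <;> simp only [h, max_eq_left, max_eq_right] <;> nlinarith

theorem nonneg_of_mul_max_neg_zero_eq_zero {y : ℝ} (h : y * max (-y) 0 = 0) : 0 ≤ y := by
  by_contra! hy
  rw [max_eq_left (by linarith)] at h
  nlinarith

theorem min_zero_cases (y : ℝ) : (0 < y ∧ min 0 y = 0) ∨ (¬ 0 < y ∧ min 0 y = y) := by
  rcases lt_or_ge 0 y with h | h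
  · exact .inl ⟨h, min_eq_left h.le⟩
  · exact .inr ⟨h.not_gt, min_eq_right h⟩

/-! ### Pointwise stationarity for a given scalar s. -/

/-- The multiplier of the constraint `w ≥ 0` if the function `v` is prescribed on `Ω⁰⁰ ∩ Ω_w`. -/
noncomputable def weight (P : LinearMPCC m) (d₁ : ℝ) (a b : Ω → ℝ) (s : ℝ) (v : Ω → ℝ) (x : Ω) :
    ℝ :=
  (P.pz ∩ P.sw).indicator (fun x => -(a x + s) / d₁) x + (P.zp ∩ P.sw).indicator b x +
    (P.zz ∩ P.sw).indicator v x

theorem memLp_weight [IsFiniteMeasure m] (P : LinearMPCC m) (d₁ : ℝ) {a b v : Ω → ℝ} (s : ℝ)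
    (ha : MemLp a 2 m) (hb : MemLp b 2 m) (hv : MemLp v 2 m) :
    MemLp (P.weight d₁ a b s v) 2 m := by
  have h : MemLp (fun x => -(a x + s) / d₁) 2 m := by
    simp only [div_eq_mul_inv]
    exact (ha.add (memLp_const s)).neg.mul_const _
  exact ((h.indicator (P.measurableSet_pz.inter P.measurableSet_sw)).add
    (hb.indicator (P.measurableSet_zp.inter P.measurableSet_sw))).add
    (hv.indicator (P.measurableSet_zz.inter P.measurableSet_sw))

/-- Pointwise form of the stationarity conditions for the multiplier `weight`. -/
theorem weight_conditions {P : LinearMPCC m} {d₁ : ℝ} (hd₁ : 0 < d₁) {s : ℝ}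
    {a b v : Ω → ℝ} {x : Ω}
    (hb : (x ∈ P.zp → x ∉ P.sw → b x = 0) ∧ (x ∈ P.zp → x ∈ P.sw → b x ≤ 0) ∧
      (x ∈ P.zz → x ∉ P.sw → 0 ≤ b x))
    (ha : (x ∈ P.pz → x ∉ P.sw → a x + s = 0) ∧ (x ∈ P.pz → x ∈ P.sw → 0 ≤ a x + s) ∧
      (x ∈ P.zz → 0 < b x → 0 ≤ a x + s))
    (hv : x ∈ P.zz → v x ≤ 0 ∧ (v x = b x ∨ (-(a x + s) / d₁ ≤ v x ∧ v x ≤ b x))) :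
    (x ∈ P.sw → P.weight d₁ a b s v x ≤ 0) ∧ (x ∉ P.sw → P.weight d₁ a b s v x = 0) ∧
      (x ∈ P.pz → a x + d₁ * P.weight d₁ a b s v x + s = 0) ∧
      (x ∈ P.zp → P.weight d₁ a b s v x = b x) ∧
      (x ∈ P.zz → (0 < a x + d₁ * P.weight d₁ a b s v x + s ∧ P.weight d₁ a b s v x < b x) ∨
        (a x + d₁ * P.weight d₁ a b s v x + s) * (P.weight d₁ a b s v x - b x) = 0) := by
  have key : ∀ {p q : ℝ}, 0 ≤ p → q ≤ 0 → (0 < p ∧ q < 0) ∨ p * q = 0 := by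
    intro p q hp hq
    rcases hp.eq_or_lt with rfl | hp
    · simp
    rcases hq.eq_or_lt with rfl | hq
    · simp
    exact .inl ⟨hp, hq⟩
  obtain ⟨hb1, hb2, hb3⟩ := hb
  obtain ⟨ha1, ha2, ha3⟩ := ha
  rcases P.mem_cases x with ⟨h1, h2, h3⟩ | ⟨h1, h2, h3⟩ | ⟨h1, h2, h3⟩ <;>
    by_cases h4 : x ∈ P.sw <;>
    simp only [weight, h1, h2, h3, h4, Set.indicator, Set.mem_inter_iff, and_self, and_true,
      true_and, and_false, not_true, not_false_iff, if_true, if_false, add_zero, zero_add,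
      forall_true_left, false_imp_iff, mul_zero] at *
  · exact hb2
  · exact hb1.symm
  -- Either v = b, so ν = 0, or the bounds on v say exactly μ ≤ 0 and ν ≤ 0, which is stronger than
  -- the M-condition.
  · refine ⟨hv.1, ?_⟩
    rcases hv.2 with h | ⟨h, h'⟩
    · simp [h]
    · rw [div_le_iff₀ hd₁] at h
      rw [← sub_neg (a := v x)]
      exact key (by linarith) (by linarith)
  · rcases hb3.eq_or_lt with h | h
    · simp [← h]
    · rcases (ha3 h).eq_or_lt with h' | h'
      · simp [← h']
      · exact .inl ⟨h', h⟩
  · refine ⟨div_nonpos_of_nonpos_of_nonneg (by linarith) hd₁.le, ?_⟩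
    field_simp
    ring
  · exact ha1

section core

variable [IsFiniteMeasure m] {P : LinearMPCC m} {d₁ d₂ : ℝ} {a b : Ω → ℝ}

/-- Signs of the reduced gradient with respect to `ξ`. -/
theorem ae_sign_of_integral_nonneg (hb : MemLp b 2 m)
    (H : ∀ t U X, P.PointwiseFeasible d₁ d₂ t U X → ∫ x, U x ∂m = t →
      0 ≤ ∫ x, (a x * U x + b x * X x) ∂m) :
    ∀ᵐ x ∂m, (x ∈ P.zp → x ∉ P.sw → b x = 0) ∧ (x ∈ P.zp → x ∈ P.sw → b x ≤ 0) ∧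
      (x ∈ P.zz → x ∉ P.sw → 0 ≤ b x) := by
  -- With U = 0 and t = 0, w ≥ 0 reads X ≤ 0 on Ω_w. In each region X is the projection of −b onto
  -- the admissible values, except that it is set to zero on Ω⁰⁰ ∩ Ω_w.
  set X : Ω → ℝ := fun x => (P.zp \ P.sw).indicator (fun x => -b x) x +
    (P.zp ∩ P.sw).indicator (fun x => min (-b x) 0) x +
    (P.zz \ P.sw).indicator (fun x => max (-b x) 0) x with hX
  have hmin : MemLp (fun x => min (-b x) 0) 2 m := hb.neg.inf (memLp_const 0)
  have hmax : MemLp (fun x => max (-b x) 0) 2 m := hb.neg.sup (memLp_const 0)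
  have hXm : MemLp X 2 m :=
    ((hb.neg.indicator (P.measurableSet_zp.diff P.measurableSet_sw)).add
      (hmin.indicator (P.measurableSet_zp.inter P.measurableSet_sw))).add
      (hmax.indicator (P.measurableSet_zz.diff P.measurableSet_sw))
  have hint := H 0 (fun _ => 0) X
    ⟨memLp_const 0, hXm, fun _ _ => rfl, fun x hx => ?_, fun x hx => ?_, fun x hx => ?_⟩ (by simp)
  · simp only [mul_zero, zero_add] at hint
    have hnonpos : ∀ x, b x * X x ≤ 0 := by
      intro x
      rcases P.mem_cases x with ⟨h1, h2, h3⟩ | ⟨h1, h2, h3⟩ | ⟨h1, h2, h3⟩ <;>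
        by_cases h4 : x ∈ P.sw <;> simp [hX, h1, h2, h4]
      · rcases le_total (-b x) 0 with h | h <;> simp only [h, min_eq_left, min_eq_right] <;>
          nlinarith
      · nlinarith
      · exact mul_max_neg_zero_nonpos (b x)
    filter_upwards [ae_eq_zero_of_nonpos_of_integral_nonneg (hb.integrable_mul hXm) hnonpos hint]
      with x hx
    rcases P.mem_cases x with ⟨h1, h2, h3⟩ | ⟨h1, h2, h3⟩ | ⟨h1, h2, h3⟩ <;>
      by_cases h4 : x ∈ P.sw <;> simp [hX, h1, h2, h4] at hx ⊢
    · grind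
    · exact hx
    · grind
  · rcases P.mem_cases x with ⟨h1, h2, h3⟩ | ⟨h1, h2, h3⟩ | ⟨h1, h2, h3⟩ <;>
      simp_all
  · rcases P.mem_cases x with ⟨h1, h2, h3⟩ | ⟨h1, h2, h3⟩ | ⟨h1, h2, h3⟩ <;>
      by_cases h4 : x ∈ P.sw <;> simp_all
  · rcases P.mem_cases x with ⟨h1, h2, h3⟩ | ⟨h1, h2, h3⟩ | ⟨h1, h2, h3⟩ <;>
      simp_all

/-! ### The scalar when Ω⁺⁰ \ Ω_w is null. -/

/-- The candidate scalar `s` satisfies all sign conditions if `Ω⁺⁰ \ Ω_w` is a null set. -/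
theorem exists_scalar_of_null (hd₁ : 0 < d₁) (hd₂ : 0 < d₂) (ha : MemLp a 2 m) (hb : MemLp b 2 m)
    (hbm : Measurable b)
    (H : ∀ t U X, P.PointwiseFeasible d₁ d₂ t U X → ∫ x, U x ∂m = t →
      0 ≤ ∫ x, (a x * U x + b x * X x) ∂m) :
    ∃ s, s = d₂ * ∫ x, P.weight d₁ a b s (fun x => min 0 (b x)) x ∂m ∧
      ∀ᵐ x ∂m, (x ∈ P.pz → x ∈ P.sw → 0 ≤ a x + s) ∧ (x ∈ P.zz → 0 < b x → 0 ≤ a x + s) := by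
  have hv : MemLp (fun x => min 0 (b x)) 2 m := (memLp_const 0).inf hb
  have hS := P.measurableSet_pz.inter P.measurableSet_sw
  obtain ⟨s, hs⟩ : ∃ s, s = d₂ * ∫ x, P.weight d₁ a b s (fun x => min 0 (b x)) x ∂m := by
    set I := ∫ x, P.weight d₁ a b 0 (fun x => min 0 (b x)) x ∂m with hI
    have hlin : ∀ s, ∫ x, P.weight d₁ a b s (fun x => min 0 (b x)) x ∂m =
        I - s / d₁ * m.real (P.pz ∩ P.sw) := by
      intro s
      have hw : ∀ x, P.weight d₁ a b s (fun x => min 0 (b x)) x =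
          P.weight d₁ a b 0 (fun x => min 0 (b x)) x -
            (P.pz ∩ P.sw).indicator (fun _ => s / d₁) x := by
        intro x
        by_cases hx : x ∈ P.pz ∩ P.sw
        · simp only [weight, Set.indicator_of_mem hx]
          ring
        · simp only [weight, Set.indicator_of_notMem hx]
          ring
      simp only [hw]
      rw [integral_sub ((P.memLp_weight d₁ 0 ha hb hv).integrable (by norm_num))
        ((integrable_const _).indicator hS), integral_indicator_const _ hS, hI, smul_eq_mul,
        mul_comm (s / d₁)]
    have hM : 0 ≤ m.real (P.pz ∩ P.sw) := measureReal_nonneg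
    -- Solution of s = d₂ (I − s m(Ω⁺⁰ ∩ Ω_w) / d₁).
    refine ⟨d₂ * I / (1 + d₂ / d₁ * m.real (P.pz ∩ P.sw)), ?_⟩
    rw [hlin]
    have : 1 + d₂ / d₁ * m.real (P.pz ∩ P.sw) ≠ 0 := by positivity
    field_simp
    ring
  refine ⟨s, hs, ?_⟩
  set N : Set Ω := (P.pz ∩ P.sw) ∪ (P.zz ∩ {x | 0 < b x}) with hN
  have hNm : MeasurableSet N :=
    hS.union (P.measurableSet_zz.inter (measurableSet_lt measurable_const hbm))
  set V : Ω → ℝ := N.indicator (fun x => max (-(a x + s)) 0) with hV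
  have has : MemLp (fun x => a x + s) 2 m := ha.add (memLp_const s)
  have hVm : MemLp V 2 m := (has.neg.sup (memLp_const 0)).indicator hNm
  have hV0 : ∀ x, 0 ≤ V x := fun x => Set.indicator_nonneg (fun _ _ => le_max_right _ _) x
  have hM : 0 ≤ m.real (P.pz ∩ P.sw) := measureReal_nonneg
  -- This t makes ∫ U = t for the U below; t ≥ 0 is needed for X ≥ 0 on Ω⁰⁰.
  obtain ⟨t, ht, ht0⟩ : ∃ t, ∫ x, V x ∂m - m.real (P.pz ∩ P.sw) * (t * d₂ / d₁) = t ∧ 0 ≤ t := by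
    refine ⟨(∫ x, V x ∂m) / (1 + d₂ / d₁ * m.real (P.pz ∩ P.sw)), ?_,
      div_nonneg (integral_nonneg hV0) (by positivity)⟩
    have : 1 + d₂ / d₁ * m.real (P.pz ∩ P.sw) ≠ 0 := by positivity
    field_simp
    ring
  set B : Set Ω := P.sw ∩ (P.zp ∪ (P.zz \ {x | 0 < b x})) with hB
  have hBm : MeasurableSet B := P.measurableSet_sw.inter (P.measurableSet_zp.union
    (P.measurableSet_zz.diff (measurableSet_lt measurable_const hbm)))
  -- The shift by t d₂ / d₁ absorbs the nonlocal term, leaving w = d₁ V on Ω⁺⁰ ∩ Ω_w; on `B`, X = d₂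
  -- t gives w = 0.
  set U : Ω → ℝ := fun x => V x - (P.pz ∩ P.sw).indicator (fun _ => t * d₂ / d₁) x with hU
  set X : Ω → ℝ := B.indicator (fun _ => d₂ * t) with hX
  have hUm : MemLp U 2 m := hVm.sub ((memLp_const _).indicator hS)
  have hXm : MemLp X 2 m := (memLp_const _).indicator hBm
  have hUt : ∫ x, U x ∂m = t := by
    rw [← ht, integral_sub (hVm.integrable (by norm_num)) ((integrable_const _).indicator hS),
      integral_indicator_const _ hS, smul_eq_mul, ht]
  have hdt : 0 ≤ d₂ * t := by positivity
  have hfeas : P.PointwiseFeasible d₁ d₂ t U X := by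
    refine ⟨hUm, hXm, fun x hx => ?_, fun x hx => ?_, fun x hx => ?_, fun x hx => ?_⟩
    · rcases P.mem_cases x with ⟨h1, h2, h3⟩ | ⟨h1, h2, h3⟩ | ⟨h1, h2, h3⟩ <;>
        simp [hU, hV, hN, h1, h2, h3] at hx ⊢
    · rcases P.mem_cases x with ⟨h1, h2, h3⟩ | ⟨h1, h2, h3⟩ | ⟨h1, h2, h3⟩ <;>
        simp [hX, hB, h1, h2, h3] at hx ⊢
    · rcases P.mem_cases x with ⟨h1, h2, h3⟩ | ⟨h1, h2, h3⟩ | ⟨h1, h2, h3⟩ <;>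
        by_cases h4 : x ∈ P.sw <;> by_cases h5 : 0 < b x <;>
        simp [hU, hX, hV, hN, hB, h1, h2, h3, h4, h5, hdt] at hx ⊢
    · have e : d₁ * (t * d₂ / d₁) = d₂ * t := by field_simp
      have := mul_nonneg hd₁.le (hV0 x)
      rcases P.mem_cases x with ⟨h1, h2, h3⟩ | ⟨h1, h2, h3⟩ | ⟨h1, h2, h3⟩ <;>
        by_cases h5 : 0 < b x <;> simp [hU, hX, hB, h1, h2, h3, hx, h5, mul_sub, e, this] <;>
        linarith
  have hint := H t U X hfeas hUt
  have hVi : Integrable (fun x => (a x + s) * V x) m := has.integrable_mul hVm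
  have hwi := (P.memLp_weight d₁ s ha hb hv).integrable (q := 2) (by norm_num)
  -- After integration the last two terms cancel by ∫ U = t and the equation for s, leaving ∫ (a +
  -- s) V.
  have hpt : ∀ x, a x * U x + b x * X x = (a x + s) * V x +
      (t * d₂) * P.weight d₁ a b s (fun x => min 0 (b x)) x - s * U x := by
    intro x
    rcases P.mem_cases x with ⟨h1, h2, h3⟩ | ⟨h1, h2, h3⟩ | ⟨h1, h2, h3⟩ <;>
      by_cases h4 : x ∈ P.sw <;> rcases min_zero_cases (b x) with ⟨h5, h6⟩ | ⟨h5, h6⟩ <;>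
      simp [weight, hU, hX, hB, h1, h2, h3, h4, h5, h6] <;> ring
  have hsum : ∫ x, (a x * U x + b x * X x) ∂m = ∫ x, (a x + s) * V x ∂m := by
    simp only [hpt]
    rw [integral_sub (by exact hVi.add (hwi.const_mul _)) ((hUm.integrable (by norm_num)).const_mul _),
      integral_add hVi (hwi.const_mul _), integral_const_mul, integral_const_mul, hUt]
    linear_combination (-t) * hs
  rw [hsum] at hint
  have hnonpos : ∀ x, (a x + s) * V x ≤ 0 := by
    intro x
    by_cases hxN : x ∈ N
    · rw [hV, Set.indicator_of_mem hxN]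
      exact mul_max_neg_zero_nonpos (a x + s)
    · simp [hV, hxN]
  filter_upwards [ae_eq_zero_of_nonpos_of_integral_nonneg hVi hnonpos hint] with x hx
  by_cases hxN : x ∈ N
  · have : 0 ≤ a x + s := by
      rw [hV, Set.indicator_of_mem hxN] at hx
      exact nonneg_of_mul_max_neg_zero_eq_zero hx
    exact ⟨fun _ _ => this, fun _ _ => this⟩
  · simp only [hN, Set.mem_union, Set.mem_inter_iff, Set.mem_ofPred_eq] at hxN
    tauto

/-! ### The scalar when Ω⁺⁰ \ Ω_w has positive measure. -/

/-- If `Ω⁺⁰ \ Ω_w` has positive measure, the coupling constraint `∫ U = t` can be dropped. -/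
theorem integral_nonneg_of_ne_null (ha : MemLp a 2 m) (hb : MemLp b 2 m)
    (H : ∀ t U X, P.PointwiseFeasible d₁ d₂ t U X → ∫ x, U x ∂m = t →
      0 ≤ ∫ x, (a x * U x + b x * X x) ∂m)
    (hE : m.real (P.pz \ P.sw) ≠ 0) {s : ℝ} (hs : ∫ x in P.pz \ P.sw, (a x + s) ∂m = 0)
    {t : ℝ} {U X : Ω → ℝ} (h : P.PointwiseFeasible d₁ d₂ t U X) :
    s * t ≤ ∫ x, ((a x + s) * U x + b x * X x) ∂m := by
  have hEm : MeasurableSet (P.pz \ P.sw) := P.measurableSet_pz.diff P.measurableSet_sw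
  have has : MemLp (fun x => a x + s) 2 m := ha.add (memLp_const s)
  -- Adding κ on Ω⁺⁰ \ Ω_w, where U is unconstrained, restores ∫ U = t. It costs nothing because a +
  -- s has mean zero there.
  obtain ⟨κ, hκ⟩ : ∃ κ : ℝ, ∫ x, U x ∂m + m.real (P.pz \ P.sw) * κ = t :=
    ⟨(t - ∫ x, U x ∂m) / m.real (P.pz \ P.sw), by field_simp; ring⟩
  set U' : Ω → ℝ := fun x => U x + (P.pz \ P.sw).indicator (fun _ => κ) x with hU'
  have hUm' : MemLp U' 2 m := h.memLp_u.add ((memLp_const κ).indicator hEm)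
  have hUt : ∫ x, U' x ∂m = t := by
    rw [integral_add (h.memLp_u.integrable (by norm_num)) ((integrable_const _).indicator hEm),
      integral_indicator_const _ hEm, smul_eq_mul, hκ]
  have hfeas : P.PointwiseFeasible d₁ d₂ t U' X := by
    refine ⟨hUm', h.memLp_ξ, fun x hx => ?_, h.ξ_pz, fun x hx => ?_, fun x hx => ?_⟩
    · have : x ∉ P.pz \ P.sw := fun hx' => Set.disjoint_left.mp P.disjoint_zp_pz hx hx'.1
      simp only [hU', Set.indicator_of_notMem this, add_zero, h.u_zp x hx]
    · have : x ∉ P.pz \ P.sw := fun hx' => Set.disjoint_left.mp P.disjoint_zz_pz hx hx'.1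
      simp only [hU', Set.indicator_of_notMem this, add_zero]
      exact h.compl x hx
    · have : x ∉ P.pz \ P.sw := fun hx' => hx'.2 hx
      simp only [hU', Set.indicator_of_notMem this, add_zero]
      exact h.w_sw x hx
  have hint := H t U' X hfeas hUt
  have hpt : ∀ x, a x * U' x + b x * X x = ((a x + s) * U x + b x * X x) +
      κ * (P.pz \ P.sw).indicator (fun x => a x + s) x - s * U' x := by
    intro x
    by_cases hx : x ∈ P.pz \ P.sw
    · simp only [hU', Set.indicator_of_mem hx]
      ring
    · simp only [hU', Set.indicator_of_notMem hx]
      ring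
  have h1 : Integrable (fun x => (a x + s) * U x + b x * X x) m :=
    (has.integrable_mul h.memLp_u).add (hb.integrable_mul h.memLp_ξ)
  have h2 : Integrable (fun x => κ * (P.pz \ P.sw).indicator (fun x => a x + s) x) m :=
    ((has.integrable (by norm_num)).indicator hEm).const_mul κ
  simp only [hpt] at hint
  rw [integral_sub (by exact h1.add h2) ((hUm'.integrable (by norm_num)).const_mul s),
    integral_add h1 h2, integral_const_mul, integral_const_mul, integral_indicator hEm, hs, hUt]
    at hint
  linarith

/-- The scalar `s` and its sign conditions if `Ω⁺⁰ \ Ω_w` has positive measure. -/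
theorem exists_scalar_of_ne_null (hd₁ : 0 < d₁) (hd₂ : 0 < d₂) (ha : MemLp a 2 m)
    (hb : MemLp b 2 m) (hbm : Measurable b)
    (H : ∀ t U X, P.PointwiseFeasible d₁ d₂ t U X → ∫ x, U x ∂m = t →
      0 ≤ ∫ x, (a x * U x + b x * X x) ∂m)
    (hE : m.real (P.pz \ P.sw) ≠ 0) :
    ∃ s, s ≤ d₂ * ∫ x, P.weight d₁ a b s (fun x => min 0 (b x)) x ∂m ∧
      d₂ * ∫ x, P.weight d₁ a b s (fun x => -(a x + s) / d₁) x ∂m ≤ s ∧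
      ∀ᵐ x ∂m, (x ∈ P.pz → x ∉ P.sw → a x + s = 0) ∧ (x ∈ P.pz → x ∈ P.sw → 0 ≤ a x + s) ∧
        (x ∈ P.zz → 0 ≤ a x + s) := by
  have hEm : MeasurableSet (P.pz \ P.sw) := P.measurableSet_pz.diff P.measurableSet_sw
  have hS := P.measurableSet_pz.inter P.measurableSet_sw
  have hai : Integrable a m := ha.integrable (by norm_num)
  obtain ⟨s, hs⟩ : ∃ s, ∫ x in P.pz \ P.sw, (a x + s) ∂m = 0 := by
    refine ⟨-(∫ x in P.pz \ P.sw, a x ∂m) / m.real (P.pz \ P.sw), ?_⟩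
    rw [integral_add hai.integrableOn (integrable_const _), setIntegral_const, smul_eq_mul]
    field_simp
    ring
  have has : MemLp (fun x => a x + s) 2 m := ha.add (memLp_const s)
  have K : ∀ t U X, P.PointwiseFeasible d₁ d₂ t U X →
      s * t ≤ ∫ x, ((a x + s) * U x + b x * X x) ∂m :=
    fun t U X h => integral_nonneg_of_ne_null ha hb H hE hs h
  refine ⟨s, ?_, ?_, ?_⟩
  · set B : Set Ω := P.sw ∩ (P.zp ∪ (P.zz \ {x | 0 < b x})) with hB
    have hBm : MeasurableSet B := P.measurableSet_sw.inter (P.measurableSet_zp.union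
      (P.measurableSet_zz.diff (measurableSet_lt measurable_const hbm)))
    -- For t = 1, the better of U = X = 0 and X = d₂ is taken on Ω⁰⁰ ∩ Ω_w, which produces min(0,
    -- b).
    have hK := K 1 ((P.pz ∩ P.sw).indicator fun _ => -d₂ / d₁) (B.indicator fun _ => d₂)
      ⟨(memLp_const _).indicator hS, (memLp_const _).indicator hBm, fun x hx => ?_,
        fun x hx => ?_, fun x hx => ?_, fun x hx => ?_⟩
    · rw [← integral_const_mul]
      rw [mul_one] at hK
      refine hK.trans_eq (integral_congr_ae (.of_forall fun x => ?_))
      rcases P.mem_cases x with ⟨h1, h2, h3⟩ | ⟨h1, h2, h3⟩ | ⟨h1, h2, h3⟩ <;>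
        by_cases h4 : x ∈ P.sw <;> rcases min_zero_cases (b x) with ⟨h5, h6⟩ | ⟨h5, h6⟩ <;>
        simp [weight, hB, h1, h2, h3, h4, h5, h6] <;> ring
    all_goals
      rcases P.mem_cases x with ⟨h1, h2, h3⟩ | ⟨h1, h2, h3⟩ | ⟨h1, h2, h3⟩ <;>
        by_cases h4 : x ∈ P.sw <;> by_cases h5 : 0 < b x <;>
        simp [hB, h1, h2, h3, h4, h5, hd₂.le] at hx ⊢
    all_goals
      field_simp
      simp
  · have hT := (P.measurableSet_pz.union P.measurableSet_zz).inter P.measurableSet_sw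
    have hZ := P.measurableSet_zp.inter P.measurableSet_sw
    -- For t = −1, w ≥ 0 is made active on Ω_w, using U on Ω⁺⁰ ∪ Ω⁰⁰ and X on Ω⁰⁺.
    have hK := K (-1) (((P.pz ∪ P.zz) ∩ P.sw).indicator fun _ => d₂ / d₁)
      ((P.zp ∩ P.sw).indicator fun _ => -d₂)
      ⟨(memLp_const _).indicator hT, (memLp_const _).indicator hZ, fun x hx => ?_,
        fun x hx => ?_, fun x hx => ?_, fun x hx => ?_⟩
    · have hpt : ∀ x, (a x + s) * ((P.pz ∪ P.zz) ∩ P.sw).indicator (fun _ => d₂ / d₁) x +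
          b x * (P.zp ∩ P.sw).indicator (fun _ => -d₂) x =
          -d₂ * P.weight d₁ a b s (fun x => -(a x + s) / d₁) x := by
        intro x
        rcases P.mem_cases x with ⟨h1, h2, h3⟩ | ⟨h1, h2, h3⟩ | ⟨h1, h2, h3⟩ <;>
          by_cases h4 : x ∈ P.sw <;> simp [weight, h1, h2, h3, h4] <;> ring
      simp only [hpt, integral_const_mul] at hK
      linarith
    all_goals
      have : 0 ≤ d₂ / d₁ := by positivity
      have e : d₁ * (d₂ / d₁) = d₂ := by field_simp
      rcases P.mem_cases x with ⟨h1, h2, h3⟩ | ⟨h1, h2, h3⟩ | ⟨h1, h2, h3⟩ <;>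
        by_cases h4 : x ∈ P.sw <;> simp [h1, h2, h3, h4, this, e] at hx ⊢
  · set N : Set Ω := (P.pz ∩ P.sw) ∪ P.zz with hN
    have hNm : MeasurableSet N := hS.union P.measurableSet_zz
    -- With t = 0 and X = 0, V is the negative part of a + s where U ≥ 0 is required, and −(a + s)
    -- where U is free.
    set V : Ω → ℝ := fun x => N.indicator (fun x => max (-(a x + s)) 0) x +
      (P.pz \ P.sw).indicator (fun x => -(a x + s)) x with hV
    have hVm : MemLp V 2 m :=
      ((has.neg.sup (memLp_const 0)).indicator hNm).add (has.neg.indicator hEm)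
    have hVN : ∀ x ∈ N, V x = max (-(a x + s)) 0 := by
      intro x hx
      have hx' : x ∉ P.pz \ P.sw := fun h => hx.elim (fun h' => h.2 h'.2)
        fun h' => Set.disjoint_left.mp P.disjoint_zz_pz h' h.1
      simp only [hV, Set.indicator_of_mem hx, Set.indicator_of_notMem hx', add_zero]
    have hVE : ∀ x ∈ P.pz \ P.sw, V x = -(a x + s) := by
      intro x hx
      have hx' : x ∉ N := fun h => h.elim (fun h' => hx.2 h'.2)
        fun h' => Set.disjoint_left.mp P.disjoint_zz_pz h' hx.1
      simp only [hV, Set.indicator_of_mem hx, Set.indicator_of_notMem hx', zero_add]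
    have hV0 : ∀ x, x ∉ N → x ∉ P.pz \ P.sw → V x = 0 := by
      intro x hx hx'
      simp only [hV, Set.indicator_of_notMem hx, Set.indicator_of_notMem hx', zero_add]
    have hVnonneg : ∀ x, x ∉ P.pz \ P.sw → 0 ≤ V x := by
      intro x hx
      by_cases hxN : x ∈ N
      · exact hVN x hxN ▸ le_max_right _ _
      · exact (hV0 x hxN hx).ge
    have hK := K 0 V (fun _ => 0)
      ⟨hVm, memLp_const 0, fun x hx => ?_, fun _ _ => rfl, fun x hx => ?_, fun x hx => ?_⟩
    · simp only [mul_zero, add_zero] at hK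
      have hnonpos : ∀ x, (a x + s) * V x ≤ 0 := by
        intro x
        by_cases hxN : x ∈ N
        · exact hVN x hxN ▸ mul_max_neg_zero_nonpos (a x + s)
        · by_cases hxE : x ∈ P.pz \ P.sw
          · rw [hVE x hxE]
            nlinarith [sq_nonneg (a x + s)]
          · simp [hV0 x hxN hxE]
      filter_upwards [ae_eq_zero_of_nonpos_of_integral_nonneg (has.integrable_mul hVm) hnonpos hK]
        with x hx
      have hpos : x ∈ N → 0 ≤ a x + s := fun h =>
        nonneg_of_mul_max_neg_zero_eq_zero (hVN x h ▸ hx)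
      refine ⟨fun h3 h4 => ?_, fun h3 h4 => hpos (.inl ⟨h3, h4⟩), fun h2 => hpos (.inr h2)⟩
      replace hx : (a x + s) * V x = 0 := hx
      rw [hVE x ⟨h3, h4⟩] at hx
      nlinarith [sq_nonneg (a x + s)]
    · refine hV0 x (fun h => h.elim (fun h' => ?_) fun h' => ?_) fun h => ?_
      · exact Set.disjoint_left.mp P.disjoint_zp_pz hx h'.1
      · exact Set.disjoint_left.mp P.disjoint_zp_zz hx h'
      · exact Set.disjoint_left.mp P.disjoint_zp_pz hx h.1
    · exact ⟨hVnonneg x fun h => Set.disjoint_left.mp P.disjoint_zz_pz hx h.1, mul_zero _, le_rfl⟩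
    · simpa using mul_nonneg hd₁.le (hVnonneg x fun h => h.2 hx)

/-! ### Solving the fixed-point equation for lam. -/

/-- The multiplier of the constraint `w ≥ 0`, together with `s = d₂ ∫ lam`. -/
theorem exists_multiplier (hd₁ : 0 < d₁) (hd₂ : 0 < d₂) (ha : MemLp a 2 m)
    (hb : MemLp b 2 m) (hbm : Measurable b)
    (H : ∀ t U X, P.PointwiseFeasible d₁ d₂ t U X → ∫ x, U x ∂m = t →
      0 ≤ ∫ x, (a x * U x + b x * X x) ∂m) :
    ∃ (s : ℝ) (lam : Ω → ℝ), MemLp lam 2 m ∧ s = d₂ * ∫ x, lam x ∂m ∧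
      ∀ᵐ x ∂m, (x ∈ P.sw → lam x ≤ 0) ∧ (x ∉ P.sw → lam x = 0) ∧
        (x ∈ P.pz → a x + d₁ * lam x + s = 0) ∧ (x ∈ P.zp → lam x = b x) ∧
        (x ∈ P.zz → (0 < a x + d₁ * lam x + s ∧ lam x < b x) ∨
          (a x + d₁ * lam x + s) * (lam x - b x) = 0) := by
  have hbs := ae_sign_of_integral_nonneg hb H
  have hv : MemLp (fun x => min 0 (b x)) 2 m := (memLp_const 0).inf hb
  by_cases hE : m.real (P.pz \ P.sw) = 0
  · obtain ⟨s, hs, has⟩ := exists_scalar_of_null hd₁ hd₂ ha hb hbm H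
    refine ⟨s, _, P.memLp_weight d₁ s ha hb hv, hs, ?_⟩
    have hE' : ∀ᵐ x ∂m, x ∉ P.pz \ P.sw := by
      rw [measureReal_eq_zero_iff] at hE
      exact measure_eq_zero_iff_ae_notMem.mp hE
    filter_upwards [has, hbs, hE'] with x hx hbx hxE
    refine weight_conditions hd₁ hbx ⟨fun h h' => absurd ⟨h, h'⟩ hxE, hx.1, hx.2⟩ fun hz => ?_
    refine ⟨min_le_left _ _, ?_⟩
    rcases min_zero_cases (b x) with ⟨h5, h6⟩ | ⟨-, h6⟩
    · rw [h6]
      exact .inr ⟨div_nonpos_of_nonpos_of_nonneg (by linarith [hx.2 hz h5]) hd₁.le, h5.le⟩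
    · exact .inl h6
  · obtain ⟨s, hs1, hs2, has⟩ := exists_scalar_of_ne_null hd₁ hd₂ ha hb hbm H hE
    have hc : MemLp (fun x => -(a x + s) / d₁) 2 m := by
      simp only [div_eq_mul_inv]
      exact (ha.add (memLp_const s)).neg.mul_const _
    -- The lower choice −(a + s) / d₁ may exceed min(0, b). Truncating it keeps the lower bracket
    -- and places both choices below min(0, b).
    have hl : MemLp (fun x => min (-(a x + s) / d₁) (min 0 (b x))) 2 m := hc.inf hv
    have hwl := P.memLp_weight d₁ s ha hb hl
    have hwh := P.memLp_weight d₁ s ha hb hv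
    have hle : ∫ x, P.weight d₁ a b s (fun x => min (-(a x + s) / d₁) (min 0 (b x))) x ∂m ≤
        ∫ x, P.weight d₁ a b s (fun x => -(a x + s) / d₁) x ∂m :=
      integral_mono (hwl.integrable (by norm_num))
        ((P.memLp_weight d₁ s ha hb hc).integrable (by norm_num))
        fun x => by
          simp only [weight]
          gcongr
          exact min_le_left _ _
    obtain ⟨θ, ⟨hθ0, hθ1⟩, hθ⟩ : ∃ θ ∈ Set.Icc (0 : ℝ) 1, s = d₂ *
        ((1 - θ) * ∫ x, P.weight d₁ a b s (fun x => min (-(a x + s) / d₁) (min 0 (b x))) x ∂m +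
          θ * ∫ x, P.weight d₁ a b s (fun x => min 0 (b x)) x ∂m) := by
      have hseg := intermediate_value_Icc (f := fun θ : ℝ => d₂ *
        ((1 - θ) * ∫ x, P.weight d₁ a b s (fun x => min (-(a x + s) / d₁) (min 0 (b x))) x ∂m +
          θ * ∫ x, P.weight d₁ a b s (fun x => min 0 (b x)) x ∂m)) zero_le_one
        (Continuous.continuousOn (by fun_prop))
      obtain ⟨θ, hθ, h⟩ := hseg (show s ∈ _ from
        ⟨by simpa using (mul_le_mul_of_nonneg_left hle hd₂.le).trans hs2, by simpa using hs1⟩)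
      exact ⟨θ, hθ, h.symm⟩
    set v : Ω → ℝ := fun x =>
      (1 - θ) * min (-(a x + s) / d₁) (min 0 (b x)) + θ * min 0 (b x) with hvdef
    have hvm : MemLp v 2 m := (hl.const_mul (1 - θ)).add (hv.const_mul θ)
    refine ⟨s, _, P.memLp_weight d₁ s ha hb hvm, ?_, ?_⟩
    · have hw : ∀ x, P.weight d₁ a b s v x =
          (1 - θ) * P.weight d₁ a b s (fun x => min (-(a x + s) / d₁) (min 0 (b x))) x +
            θ * P.weight d₁ a b s (fun x => min 0 (b x)) x := by
        intro x
        by_cases hx : x ∈ P.zz ∩ P.sw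
        · simp only [weight, Set.indicator_of_mem hx, hvdef]
          ring
        · simp only [weight, Set.indicator_of_notMem hx]
          ring
      simp only [hw]
      rw [integral_add ((hwl.integrable (by norm_num)).const_mul _)
        ((hwh.integrable (by norm_num)).const_mul _), integral_const_mul, integral_const_mul]
      exact hθ
    · filter_upwards [has, hbs] with x hx hbx
      refine weight_conditions hd₁ hbx ⟨hx.1, hx.2.1, fun hz _ => hx.2.2 hz⟩ fun hz => ?_
      have hc0 : -(a x + s) / d₁ ≤ 0 :=
        div_nonpos_of_nonpos_of_nonneg (by linarith [hx.2.2 hz]) hd₁.le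
      simp only [hvdef]
      have hm0 := min_le_left 0 (b x)
      have hmb := min_le_right 0 (b x)
      rcases le_total (-(a x + s) / d₁) (min 0 (b x)) with h | h
      -- Here v lies between −(a + s) / d₁ and min(0, b); in the other case both interpolated
      -- choices equal min(0, b).
      · rw [min_eq_left h]
        exact ⟨by nlinarith, .inr ⟨by nlinarith, by nlinarith⟩⟩
      · rw [min_eq_right h]
        have e : (1 - θ) * min 0 (b x) + θ * min 0 (b x) = min 0 (b x) := by ring
        rw [e]
        refine ⟨hm0, ?_⟩
        rcases min_zero_cases (b x) with ⟨h5, h6⟩ | ⟨-, h6⟩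
        · exact .inr ⟨hc0.trans_eq h6.symm, hmb⟩
        · exact .inl h6

end core

end LinearMPCC

theorem mainTheorem4 {Ω : Type*} [MeasurableSpace Ω] (m : Measure Ω) [IsFiniteMeasure m]
    (P : LinearMPCC m) (d₁ d₂ : ℝ) (hd₁ : 0 < d₁) (hd₂ : 0 < d₂)
    (hA : ∀ v : Lp ℝ 2 m, ∀ᵐ x ∂m, P.A v x = d₁ * v x + d₂ * ∫ y, v y ∂m)
    (hmin : P.IsMinimizer 0 0 0) :
    P.IsMStationary 0 0 0 := by
  rw [LinearMPCC.isMStationary_zero_iff]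
  set a : Lp ℝ 2 m := P.Fu + P.A P.Fw
  set b : Lp ℝ 2 m := P.Fξ - P.Fw
  obtain ⟨s, f, hf, hs, hcond⟩ := LinearMPCC.exists_multiplier (P := P) (a := a) (b := b) hd₁ hd₂
    (Lp.memLp a) (Lp.memLp b) (Lp.stronglyMeasurable b).measurable
    fun t U X h ht => hmin.integral_nonneg hA h ht
  set lam : Lp ℝ 2 m := hf.toLp f
  have hlam : lam =ᵐ[m] f := hf.coeFn_toLp
  have hs' : d₂ * ∫ x, lam x ∂m = s := by rw [hs, integral_congr_ae hlam]
  have hμ : ∀ᵐ x ∂m, (-(a + P.A lam) : Lp ℝ 2 m) x = -(a x + d₁ * f x + s) := by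
    filter_upwards [Lp.coeFn_neg (a + P.A lam), Lp.coeFn_add a (P.A lam), hA lam, hlam]
      with x h1 h2 h3 h4
    rw [h1, Pi.neg_apply, h2, Pi.add_apply, h3, hs', h4]
    ring
  have hν : ∀ᵐ x ∂m, (lam - b : Lp ℝ 2 m) x = f x - b x := by
    filter_upwards [Lp.coeFn_sub lam b, hlam] with x h1 h2
    rw [h1, Pi.sub_apply, h2]
  refine ⟨P.Fw + lam, -(a + P.A lam), lam, lam - b, ?_, by abel, ?_, ?_, ?_, ?_, ?_, ?_⟩
  · rw [LinearMPCC.adjoint_eq_self P.A d₁ d₂ hA, map_add]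
    simp only [a]
    abel
  · simp only [b]
    abel
  · filter_upwards [hcond, hlam] with x h h'
    exact h' ▸ h.1
  · filter_upwards [hcond, hlam] with x h h'
    exact h' ▸ h.2.1
  · filter_upwards [hcond, hμ] with x h h' hx
    rw [h', h.2.2.1 hx, neg_zero]
  · filter_upwards [hcond, hν] with x h h' hx
    rw [h', h.2.2.2.1 hx, sub_self]
  · filter_upwards [hcond, hμ, hν] with x h h1 h2 hx
    rw [h1, h2]
    rcases h.2.2.2.2 hx with ⟨h3, h4⟩ | h3
    · exact .inl ⟨neg_neg_of_pos h3, sub_neg_of_lt h4⟩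
    · exact .inr (by rw [neg_mul, h3, neg_zero])
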